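/- Let $0<\alpha,\beta<1$, let $k>0$ be a time step, and put $t_n=nk$. Write $(\cdot,\cdot)$ and $\|\cdot\|$ for the inner product and norm of the real space $L^2(\mathbb R)$, $H^1(\mathbb R)$ for the set of $u\in L^2(\mathbb R)$ with weak derivative $u_x\in L^2(\mathbb R)$, and, for $1\le i\le n$, $$c_{n,i}=\frac{1}{\beta\,\Gamma(\beta)}\left(\left(1-\left(\frac{i-1}{n}\right)^{\alpha/\beta}\right)^{\beta}-\left(1-\left(\frac{i}{n}\right)^{\alpha/\beta}\right)^{\beta}\right).$$ For a grid function $\phi$ with values $\phi(t_i)$ put $L\phi(t_n)=\sum_{i=1}^{n}c_{n,i}\,\phi(t_i)$ (so $L\phi(t_0)=0$), and let $$G\phi(t_n)=\beta\,L\phi(t_n)+\frac{\beta}{\alpha}\,t_n\,\frac{L\phi(t_n)-L\phi(t_{n-1})}{k},\qquad n\ge 1,$$ be the discrete Erdélyi–Kober derivative. Consider the time-discrete problem for $U^n\in H^1(\mathbb R)$, $n\ge 1$, with initial value $U^0=u_0$: $$\left(\frac{U^n-U^{n-1}}{k},\chi\right)=-\frac{\alpha}{\beta}\,t_n^{\alpha-1}\,\bigl(G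 U^n_x,\chi_x\bigr)\qquad\text{for all }\chi\in H^1(\mathbb R),\tag{$*$}$$ where $GU^n_x$ is the value at $t_n$ of $G$ applied to the grid function $t_i\mapsto U^i_x$. Then for every $n\ge1$, every $U^0\in L^2(\mathbb R)$ and all $U^1,\dots,U^{n-1}\in H^1(\mathbb R)$ there is exactly one $U^n\in H^1(\mathbb R)$ satisfying $(*)$. Consequently, for every $u_0\in L^2(\mathbb R)$ the time-discrete problem has exactly one solution $(U^n)_{n\ge0}$ with $U^0=u_0$ and $U^n\in H^1(\mathbb R)$ for all $n\ge 1$. This solution is stable: $$\|U^n\|\le\sqrt2\,\|U^0\|\qquad\text{for all } n\ge0.$$ -/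

import Mathlib

open MeasureTheory
open scoped ContDiff

noncomputable section

namespace EKDiffusion

/-- The real Hilbert space `L²(ℝ)`. -/
abbrev L2R : Type := Lp ℝ 2 (volume : Measure ℝ)

/-- `v` is the weak derivative of `u`: `∫ u φ' = - ∫ v φ` for every smooth, compactly supported
test function `φ`. -/
def HasWeakDeriv (u v : L2R) : Prop :=
  ∀ φ : ℝ → ℝ, ContDiff ℝ ∞ φ → HasCompactSupport φ →
    ∫ x, u x * deriv φ x = -∫ x, v x * φ x

/-- The Sobolev space `H¹(ℝ)`: the elements of `L²(ℝ)` with a weak derivative in `L²(ℝ)`. -/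
def H1 : Set L2R := {u | ∃ v : L2R, HasWeakDeriv u v}

open Classical in
/-- The weak derivative `u_x` of `u ∈ H¹(ℝ)` (and `0` if `u` is not in `H¹(ℝ)`). -/
def weakDeriv (u : L2R) : L2R := if h : ∃ v : L2R, HasWeakDeriv u v then h.choose else 0

/-- Weak derivatives are unique. -/
theorem HasWeakDeriv.unique {u v w : L2R} (hv : HasWeakDeriv u v) (hw : HasWeakDeriv u w) :
    v = w := by
  refine Lp.ext ?_
  refine ae_eq_of_integral_contDiff_smul_eq
    ((Lp.memLp v).locallyIntegrable (by norm_num)) ((Lp.memLp w).locallyIntegrable (by norm_num))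
    fun φ hφ hc => ?_
  have h := (hv φ hφ hc).symm.trans (hw φ hφ hc)
  simpa [smul_eq_mul, mul_comm] using h

theorem HasWeakDeriv.weakDeriv_eq {u v : L2R} (hv : HasWeakDeriv u v) : weakDeriv u = v := by
  have h : ∃ v : L2R, HasWeakDeriv u v := ⟨v, hv⟩
  rw [weakDeriv, dif_pos h]
  exact h.choose_spec.unique hv

/-- The weights of the rectangle rule,
`c_{n,i} = ((1 - ((i-1)/n)^(α/β))^β - (1 - (i/n)^(α/β))^β) / (β Γ(β))`, for `1 ≤ i ≤ n`. -/
def coeff (α β : ℝ) (n i : ℕ) : ℝ :=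
  1 / (β * Real.Gamma β) *
    ((1 - (((i : ℝ) - 1) / (n : ℝ)) ^ (α / β)) ^ β - (1 - ((i : ℝ) / (n : ℝ)) ^ (α / β)) ^ β)

/-- The discrete Erdélyi–Kober integral `L φ(t_n) = ∑_{i=1}^n c_{n,i} φ(t_i)` of a grid function
`φ`, whose value `φ i` stands for `φ(t_i)`. -/
def discreteEKInt {E : Type*} [AddCommGroup E] [Module ℝ E] (α β : ℝ) (φ : ℕ → E) (n : ℕ) : E :=
  ∑ i ∈ Finset.Icc 1 n, coeff α β n i • φ i

/-- The discrete Erdélyi–Kober derivative at `t_n = n k`, for `n ≥ 1`,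
`G φ(t_n) = β L φ(t_n) + (β/α) t_n (1/k) (L φ(t_n) - L φ(t_{n-1}))`. -/
def discreteEKDeriv {E : Type*} [AddCommGroup E] [Module ℝ E] (α β k : ℝ) (φ : ℕ → E) (n : ℕ) :
    E :=
  β • discreteEKInt α β φ n +
    (β / α * ((n : ℝ) * k) * (1 / k)) • (discreteEKInt α β φ n - discreteEKInt α β φ (n - 1))

/-- The equation of the `n`-th time step (`n ≥ 1`, `t_n = n k`):
`((Uⁿ - Uⁿ⁻¹)/k, χ) = -(α/β) t_n^(α-1) (G U_xⁿ, χ_x)` for all `χ ∈ H¹(ℝ)`.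
It involves only `U⁰, …, Uⁿ`. -/
def StepEq (α β k : ℝ) (U : ℕ → L2R) (n : ℕ) : Prop :=
  ∀ χ ∈ H1, inner ℝ ((1 / k) • (U n - U (n - 1))) χ =
    -(α / β * ((n : ℝ) * k) ^ (α - 1) *
      inner ℝ (discreteEKDeriv α β k (fun i => weakDeriv (U i)) n) (weakDeriv χ))

/-- `U` solves the time-discrete scheme with step `k` and initial value `u₀`: `U⁰ = u₀` and, for
all `n ≥ 1`, `Uⁿ ∈ H¹(ℝ)` satisfies the equation of the `n`-th step. -/
def IsSchemeSolution (α β k : ℝ) (u₀ : L2R) (U : ℕ → L2R) : Prop :=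
  U 0 = u₀ ∧ ∀ n : ℕ, 1 ≤ n → U n ∈ H1 ∧ StepEq α β k U n

end EKDiffusion

end

namespace EKDiffusion

/-! Multiplied by `α/β`, the discrete derivative is a lower triangular sum of the `φ i` with `i ≥
1`, so no derivative of the initial value enters. Its diagonal weights are positive, so each step is
an elliptic problem on the line, solved by orthogonal projection onto the closed graph of the weak
derivative (`existsUnique_elliptic`). For stability, the step is tested with its own solution and
summed. What remains is the sign of the quadratic form with matrix `n^(α-1) * derivWeight α β n i`
(`sum_inner_discreteEKDeriv_nonneg`): off-diagonal entries are nonpositive, row and column sums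
nonnegative, so `2(x,y) ≤ ‖x‖² + ‖y‖²` gives nonnegativity. Concavity of powers supplies these
signs. The bound obtained has constant 1. -/

/-- Concavity of `x ↦ x ^ β` in the form of decreasing increments. -/
theorem rpow_add_add_rpow_le {β p d h : ℝ} (hβ0 : 0 ≤ β) (hβ1 : β ≤ 1) (hp : 0 ≤ p)
    (hd : 0 ≤ d) (hh : 0 ≤ h) :
    (p + d + h) ^ β + p ^ β ≤ (p + d) ^ β + (p + h) ^ β := by
  rcases (add_nonneg hd hh).eq_or_lt with h0 | h0
  · have h1 : d = 0 := by linarith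
    have h2 : h = 0 := by linarith
    simp [h1, h2]
  have hc := Real.concaveOn_rpow hβ0 hβ1
  have hq : p + d + h ∈ Set.Ici (0 : ℝ) := Set.mem_Ici.2 (by positivity)
  have e : h / (d + h) + d / (d + h) = 1 := by field_simp; ring
  have e' : d / (d + h) + h / (d + h) = 1 := by field_simp
  have h1 := hc.2 (Set.mem_Ici.2 hp) hq (div_nonneg hh h0.le) (div_nonneg hd h0.le) e
  have h2 := hc.2 (Set.mem_Ici.2 hp) hq (div_nonneg hd h0.le) (div_nonneg hh h0.le) e'
  have e1 : h / (d + h) * p + d / (d + h) * (p + d + h) = p + d := by field_simp; ring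
  have e2 : d / (d + h) * p + h / (d + h) * (p + d + h) = p + h := by field_simp; ring
  simp only [smul_eq_mul, e1, e2] at h1 h2
  have e3 : (h / (d + h) * p ^ β + d / (d + h) * (p + d + h) ^ β) +
      (d / (d + h) * p ^ β + h / (d + h) * (p + d + h) ^ β) = (p + d + h) ^ β + p ^ β := by
    linear_combination (p ^ β + (p + d + h) ^ β) * e
  linarith

/-! ### Signs and sums of the weights -/

section Coeff

variable {α β : ℝ}

theorem sub_one_div_nonneg {n i : ℕ} (hi : 1 ≤ i) : 0 ≤ ((i : ℝ) - 1) / n := by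
  have : (1 : ℝ) ≤ i := by exact_mod_cast hi
  exact div_nonneg (by linarith) (Nat.cast_nonneg n)

theorem coeff_prefactor_pos (hβ : 0 < β) : 0 < 1 / (β * Real.Gamma β) :=
  one_div_pos.2 (mul_pos hβ (Real.Gamma_pos_of_pos hβ))

theorem coeff_nonneg (hα : 0 < α) (hβ : 0 < β) {n i : ℕ} (hi : 1 ≤ i) (hin : i ≤ n) :
    0 ≤ coeff α β n i := by
  have hn : (0 : ℝ) < n := by exact_mod_cast (by omega : 0 < n)
  refine mul_nonneg (coeff_prefactor_pos hβ).le (sub_nonneg.2 ?_)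
  have h1 : ((i : ℝ) / n) ^ (α / β) ≤ 1 :=
    Real.rpow_le_one (by positivity) ((div_le_one hn).2 (by exact_mod_cast hin)) (by positivity)
  have h2 : (((i : ℝ) - 1) / n) ^ (α / β) ≤ ((i : ℝ) / n) ^ (α / β) :=
    Real.rpow_le_rpow (sub_one_div_nonneg hi)
      (div_le_div_of_nonneg_right (by linarith) hn.le) (by positivity)
  exact Real.rpow_le_rpow (by linarith) (by linarith) hβ.le

theorem coeff_self_pos (hα : 0 < α) (hβ : 0 < β) {n : ℕ} (hn : 1 ≤ n) : 0 < coeff α β n n := by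
  have hn' : (0 : ℝ) < n := by exact_mod_cast hn
  refine mul_pos (coeff_prefactor_pos hβ) ?_
  have h1 : (((n : ℝ) - 1) / n) ^ (α / β) < 1 :=
    Real.rpow_lt_one (sub_one_div_nonneg hn) ((div_lt_one hn').2 (by linarith)) (by positivity)
  rw [div_self hn'.ne', Real.one_rpow, sub_self, Real.zero_rpow hβ.ne', sub_zero]
  exact Real.rpow_pos_of_pos (by linarith) _

theorem sum_coeff (hα : 0 < α) (hβ : 0 < β) {n : ℕ} (hn : 1 ≤ n) :
    ∑ i ∈ Finset.Icc 1 n, coeff α β n i = 1 / (β * Real.Gamma β) := by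
  have key : ∀ m : ℕ, ∑ i ∈ Finset.Icc 1 m, coeff α β n i =
      1 / (β * Real.Gamma β) * (1 - (1 - ((m : ℝ) / n) ^ (α / β)) ^ β) := by
    intro m
    induction m with
    | zero => simp [Real.zero_rpow (div_pos hα hβ).ne']
    | succ m ih =>
      rw [Finset.sum_Icc_succ_top (by omega), ih, coeff]
      push_cast
      rw [add_sub_cancel_right]
      ring
  have hn' : (n : ℝ) ≠ 0 := by exact_mod_cast (by omega : n ≠ 0)
  rw [key n, div_self hn', Real.one_rpow, sub_self, Real.zero_rpow hβ.ne', sub_zero, mul_one]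

/-- Homogeneity: the factor `x^α` clears the denominator, so scaled weights depend on `n` only
through `n^(α/β)`. -/
theorem rpow_mul_one_sub_div_rpow (hβ : 0 < β) {x y : ℝ} (hx : 0 < x) (hy : 0 ≤ y) (hyx : y ≤ x)
    (hα : 0 < α) :
    x ^ α * (1 - (y / x) ^ (α / β)) ^ β = (x ^ (α / β) - y ^ (α / β)) ^ β := by
  have h1 : (y / x) ^ (α / β) ≤ 1 :=
    Real.rpow_le_one (by positivity) ((div_le_one hx).2 hyx) (by positivity)
  have h2 : x ^ α = (x ^ (α / β)) ^ β := by
    rw [← Real.rpow_mul hx.le, div_mul_cancel₀ _ hβ.ne']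
  rw [h2, ← Real.mul_rpow (by positivity) (by linarith), Real.div_rpow hy hx.le, mul_sub, mul_one,
    mul_div_cancel₀ _ (Real.rpow_pos_of_pos hx _).ne']

theorem rpow_mul_coeff (hα : 0 < α) (hβ : 0 < β) {n i : ℕ} (hi : 1 ≤ i) (hin : i ≤ n) :
    (n : ℝ) ^ α * coeff α β n i = 1 / (β * Real.Gamma β) *
      (((n : ℝ) ^ (α / β) - ((i : ℝ) - 1) ^ (α / β)) ^ β -
        ((n : ℝ) ^ (α / β) - (i : ℝ) ^ (α / β)) ^ β) := by
  have hn : (0 : ℝ) < n := by exact_mod_cast (by omega : 0 < n)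
  have hi' : (1 : ℝ) ≤ i := by exact_mod_cast hi
  have hin' : (i : ℝ) ≤ n := by exact_mod_cast hin
  rw [← rpow_mul_one_sub_div_rpow hβ hn (by linarith : (0 : ℝ) ≤ i - 1) (by linarith) hα,
    ← rpow_mul_one_sub_div_rpow hβ hn (by linarith : (0 : ℝ) ≤ i) hin' hα, coeff]
  ring

theorem rpow_mul_coeff_succ_le (hα : 0 < α) (hβ0 : 0 < β) (hβ1 : β ≤ 1) {n i : ℕ} (hi : 1 ≤ i)
    (hin : i ≤ n) :
    ((n : ℝ) + 1) ^ α * coeff α β (n + 1) i ≤ (n : ℝ) ^ α * coeff α β n i := by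
  have h := rpow_mul_coeff hα hβ0 hi (hin.trans n.le_succ)
  push_cast at h
  rw [h, rpow_mul_coeff hα hβ0 hi hin]
  refine mul_le_mul_of_nonneg_left ?_ (coeff_prefactor_pos hβ0).le
  have hi' : (1 : ℝ) ≤ i := by exact_mod_cast hi
  have hin' : (i : ℝ) ≤ n := by exact_mod_cast hin
  have hρ : 0 ≤ α / β := by positivity
  have h1 : ((i : ℝ) - 1) ^ (α / β) ≤ (i : ℝ) ^ (α / β) :=
    Real.rpow_le_rpow (by linarith) (by linarith) hρ
  have h2 : (i : ℝ) ^ (α / β) ≤ (n : ℝ) ^ (α / β) := Real.rpow_le_rpow (by linarith) hin' hρ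
  have h3 : (n : ℝ) ^ (α / β) ≤ ((n : ℝ) + 1) ^ (α / β) :=
    Real.rpow_le_rpow (by linarith) (by linarith) hρ
  -- With `ρ = α/β`: `p = n^ρ - i^ρ`, `d = i^ρ - (i-1)^ρ`, `h = (n+1)^ρ - n^ρ`. The increment over
  -- length `d` shrinks when shifted by `h`.
  have := rpow_add_add_rpow_le hβ0.le hβ1 (sub_nonneg.2 h2) (sub_nonneg.2 h1) (sub_nonneg.2 h3)
  ring_nf at this ⊢
  linarith

theorem add_one_rpow_le (hα0 : 0 ≤ α) (hα1 : α ≤ 1) {x : ℝ} (hx : 0 < x) :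
    (x + 1) ^ α ≤ x ^ (α - 1) * (α + x) := by
  have h := rpow_one_add_le_one_add_mul_self (s := 1 / x)
    (by have : 0 < 1 / x := by positivity
        linarith) hα0 hα1
  have e : x + 1 = x * (1 + 1 / x) := by field_simp
  rw [e, Real.mul_rpow hx.le (by positivity), Real.rpow_sub_one hx.ne']
  calc x ^ α * (1 + 1 / x) ^ α ≤ x ^ α * (1 + α * (1 / x)) :=
        mul_le_mul_of_nonneg_left h (by positivity)
    _ = x ^ α / x * (α + x) := by field_simp; ring

/-- This is the off-diagonal sign. Bernoulli's inequality bounds `n^α` by `x^α (1 - α/x)` with `x =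
n + 1`, and `(α + x)(1 - α/x) = x - α²/x ≤ x`. -/
theorem coeff_succ_le (hα0 : 0 < α) (hα1 : α ≤ 1) (hβ0 : 0 < β) (hβ1 : β ≤ 1) {n i : ℕ}
    (hi : 1 ≤ i) (hin : i ≤ n) :
    (α + (n + 1)) * coeff α β (n + 1) i ≤ (n + 1) * coeff α β n i := by
  have hn : (0 : ℝ) < n := by exact_mod_cast (by omega : 0 < n)
  have h := rpow_mul_coeff_succ_le hα0 hβ0 hβ1 hi hin
  have c0 := coeff_nonneg hα0 hβ0 hi hin
  have c1 := coeff_nonneg hα0 hβ0 hi (hin.trans n.le_succ)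
  set x : ℝ := (n : ℝ) + 1 with hx
  have hx0 : 0 < x := by positivity
  have hb : (n : ℝ) ^ α ≤ x ^ α * (1 - α / x) := by
    have := rpow_one_add_le_one_add_mul_self (s := -(1 / x))
      (by have : 1 / x ≤ 1 := (div_le_one hx0).2 (by linarith)
          linarith) hα0.le hα1
    have e : (n : ℝ) = x * (1 + -(1 / x)) := by field_simp; linarith
    have h1x : 1 / x ≤ 1 := (div_le_one hx0).2 (by linarith)
    rw [e, Real.mul_rpow hx0.le (by linarith)]
    refine mul_le_mul_of_nonneg_left (this.trans_eq ?_) (by positivity)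
    ring
  have h2 : coeff α β (n + 1) i ≤ (1 - α / x) * coeff α β n i := by
    refine le_of_mul_le_mul_left ?_ (Real.rpow_pos_of_pos hx0 α)
    calc _ ≤ _ := h
      _ ≤ x ^ α * (1 - α / x) * coeff α β n i := mul_le_mul_of_nonneg_right hb c0
      _ = _ := by ring
  calc (α + x) * coeff α β (n + 1) i ≤ (α + x) * ((1 - α / x) * coeff α β n i) :=
        mul_le_mul_of_nonneg_left h2 (by positivity)
    _ = (x - α ^ 2 / x) * coeff α β n i := by field_simp; ring
    _ ≤ x * coeff α β n i := by
        refine mul_le_mul_of_nonneg_right ?_ c0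
        have : 0 ≤ α ^ 2 / x := by positivity
        linarith

/-- The weight of `φ(t_i)` in `(α/β) G φ(t_n)`, for `1 ≤ i ≤ n`. -/
noncomputable def derivWeight (α β : ℝ) (n i : ℕ) : ℝ :=
  (α + n) * coeff α β n i - if i < n then (n : ℝ) * coeff α β (n - 1) i else 0

theorem derivWeight_self (n : ℕ) : derivWeight α β n n = (α + n) * coeff α β n n := by
  simp [derivWeight]

theorem derivWeight_self_pos (hα : 0 < α) (hβ : 0 < β) {n : ℕ} (hn : 1 ≤ n) :
    0 < derivWeight α β n n := by
  rw [derivWeight_self]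
  exact mul_pos (by positivity) (coeff_self_pos hα hβ hn)

theorem derivWeight_succ_of_le {n i : ℕ} (hin : i ≤ n) : derivWeight α β (n + 1) i =
    (α + (n + 1)) * coeff α β (n + 1) i - (n + 1) * coeff α β n i := by
  simp [derivWeight, Nat.lt_succ_of_le hin]

theorem derivWeight_nonpos (hα0 : 0 < α) (hα1 : α ≤ 1) (hβ0 : 0 < β) (hβ1 : β ≤ 1) {n i : ℕ}
    (hi : 1 ≤ i) (hin : i < n) : derivWeight α β n i ≤ 0 := by
  obtain ⟨m, rfl⟩ : ∃ m, n = m + 1 := ⟨n - 1, by omega⟩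
  rw [derivWeight_succ_of_le (by omega)]
  exact sub_nonpos.2 (coeff_succ_le hα0 hα1 hβ0 hβ1 hi (by omega))

/-- Since `t_n / k = n`, the step size cancels. -/
theorem smul_discreteEKDeriv {E : Type*} [AddCommGroup E] [Module ℝ E] (hα : 0 < α) (hβ : 0 < β)
    {k : ℝ} (hk : 0 < k) (φ : ℕ → E) {n : ℕ} (hn : 1 ≤ n) :
    (α / β) • discreteEKDeriv α β k φ n = ∑ i ∈ Finset.Icc 1 n, derivWeight α β n i • φ i := by
  obtain ⟨m, rfl⟩ : ∃ m, n = m + 1 := ⟨n - 1, by omega⟩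
  have e1 : α / β * β = α := by field_simp
  have e2 : α / β * (β / α * (((m + 1 : ℕ) : ℝ) * k) * (1 / k)) = m + 1 := by
    push_cast
    field_simp
  rw [discreteEKDeriv, smul_add, smul_smul, smul_smul, e1, e2, discreteEKInt, discreteEKInt,
    Finset.sum_Icc_succ_top (by omega), Finset.sum_Icc_succ_top (by omega), derivWeight_self,
    Nat.add_sub_cancel]
  have : ∑ i ∈ Finset.Icc 1 m, derivWeight α β (m + 1) i • φ i =
      (α + (m + 1)) • ∑ i ∈ Finset.Icc 1 m, coeff α β (m + 1) i • φ i -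
        ((m : ℝ) + 1) • ∑ i ∈ Finset.Icc 1 m, coeff α β m i • φ i := by
    rw [Finset.smul_sum, Finset.smul_sum, ← Finset.sum_sub_distrib]
    refine Finset.sum_congr rfl fun i hi => ?_
    rw [derivWeight_succ_of_le (Finset.mem_Icc.1 hi).2, smul_smul, smul_smul, ← sub_smul]
  rw [this]
  push_cast
  module

/-- The row sum is `(α/β) G` applied to the constant 1, whose discrete integral does not decrease:
it is 0 at `t_0` and constant afterwards. -/
theorem sum_derivWeight_nonneg (hα : 0 < α) (hβ : 0 < β) {n : ℕ} (hn : 1 ≤ n) :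
    0 ≤ ∑ i ∈ Finset.Icc 1 n, derivWeight α β n i := by
  have hp := coeff_prefactor_pos hβ
  have h := smul_discreteEKDeriv hα hβ one_pos (fun _ => (1 : ℝ)) hn
  simp only [smul_eq_mul, mul_one] at h
  rw [← h]
  simp only [discreteEKDeriv, discreteEKInt, smul_eq_mul, mul_one, div_one]
  rw [sum_coeff hα hβ hn]
  have h1 : ∑ i ∈ Finset.Icc 1 (n - 1), coeff α β (n - 1) i ≤ 1 / (β * Real.Gamma β) := by
    rcases Nat.eq_zero_or_pos (n - 1) with h0 | h0
    · simpa [h0] using hp.le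
    · exact (sum_coeff hα hβ h0).le
  have := sub_nonneg.2 h1
  positivity

/-- The column almost telescopes: by `add_one_rpow_le`, the bound for row `N` absorbs the term
`(N+1)^α c_{N,i}` subtracted in row `N + 1`. -/
theorem rpow_mul_coeff_le_sum_derivWeight (hα0 : 0 < α) (hα1 : α ≤ 1) (hβ0 : 0 < β) {i N : ℕ}
    (hi : 1 ≤ i) (hiN : i ≤ N) :
    (N : ℝ) ^ (α - 1) * (α + N) * coeff α β N i ≤
      ∑ n ∈ Finset.Icc i N, (n : ℝ) ^ (α - 1) * derivWeight α β n i := by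
  induction N, hiN using Nat.le_induction with
  | base => simp [derivWeight_self, mul_assoc]
  | succ N hiN ih =>
    have hN : (0 : ℝ) < N := by exact_mod_cast (by omega : 0 < N)
    rw [Finset.sum_Icc_succ_top (by omega), derivWeight_succ_of_le hiN]
    have h1 := mul_le_mul_of_nonneg_right (add_one_rpow_le hα0.le hα1 hN)
      (coeff_nonneg hα0 hβ0 hi hiN)
    have h2 : ((N : ℝ) + 1) ^ α = ((N : ℝ) + 1) ^ (α - 1) * (N + 1) := by
      rw [Real.rpow_sub_one (by positivity), div_mul_cancel₀ _ (by positivity)]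
    rw [h2] at h1
    push_cast
    linarith

theorem sum_rpow_mul_derivWeight_nonneg (hα0 : 0 < α) (hα1 : α ≤ 1) (hβ0 : 0 < β) {i N : ℕ}
    (hi : 1 ≤ i) (hiN : i ≤ N) :
    0 ≤ ∑ n ∈ Finset.Icc i N, (n : ℝ) ^ (α - 1) * derivWeight α β n i := by
  have := coeff_nonneg hα0 hβ0 hi hiN
  exact le_trans (by positivity) (rpow_mul_coeff_le_sum_derivWeight hα0 hα1 hβ0 hi hiN)

end Coeff

/-! ### Positivity of the quadratic form -/

section Positivity

variable {E : Type*} [NormedAddCommGroup E] [InnerProductSpace ℝ E]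

/-- A lower triangular quadratic form with nonpositive off-diagonal entries and nonnegative row and
column sums is nonnegative. -/
theorem sum_inner_triangular_nonneg (a : ℕ → ℕ → ℝ) (φ : ℕ → E) (N : ℕ)
    (hoff : ∀ n i, 1 ≤ i → i < n → a n i ≤ 0)
    (hrow : ∀ n, 1 ≤ n → 0 ≤ ∑ i ∈ Finset.Icc 1 n, a n i)
    (hcol : ∀ i, 1 ≤ i → i ≤ N → 0 ≤ ∑ n ∈ Finset.Icc i N, a n i) :
    0 ≤ ∑ n ∈ Finset.Icc 1 N, inner ℝ (∑ i ∈ Finset.Icc 1 n, a n i • φ i) (φ n) := by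
  have hterm : ∀ n i, 1 ≤ i → i ≤ n →
      a n i * ((‖φ n‖ ^ 2 + ‖φ i‖ ^ 2) / 2) ≤ inner ℝ (a n i • φ i) (φ n) := by
    intro n i hi hin
    rw [real_inner_smul_left]
    rcases hin.eq_or_lt with rfl | h
    · rw [real_inner_self_eq_norm_sq]
      exact le_of_eq (by ring)
    -- The nonpositive weight reverses `(φ i, φ n) ≤ (‖φ n‖² + ‖φ i‖²)/2`.
    · refine mul_le_mul_of_nonpos_left ?_ (hoff n i hi h)
      have := norm_sub_sq_real (φ i) (φ n)
      nlinarith [sq_nonneg ‖φ i - φ n‖]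
  have h1 : ∑ n ∈ Finset.Icc 1 N, ∑ i ∈ Finset.Icc 1 n, a n i * ((‖φ n‖ ^ 2 + ‖φ i‖ ^ 2) / 2) ≤
      ∑ n ∈ Finset.Icc 1 N, inner ℝ (∑ i ∈ Finset.Icc 1 n, a n i • φ i) (φ n) := by
    refine Finset.sum_le_sum fun n _ => ?_
    rw [sum_inner]
    refine Finset.sum_le_sum fun i hi => ?_
    exact hterm n i (Finset.mem_Icc.1 hi).1 (Finset.mem_Icc.1 hi).2
  refine le_trans ?_ h1
  have h2 : ∑ n ∈ Finset.Icc 1 N, ∑ i ∈ Finset.Icc 1 n, a n i * ((‖φ n‖ ^ 2 + ‖φ i‖ ^ 2) / 2) =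
      ∑ n ∈ Finset.Icc 1 N, (∑ i ∈ Finset.Icc 1 n, a n i) * (‖φ n‖ ^ 2 / 2) +
        ∑ n ∈ Finset.Icc 1 N, ∑ i ∈ Finset.Icc 1 n, a n i * (‖φ i‖ ^ 2 / 2) := by
    rw [← Finset.sum_add_distrib]
    refine Finset.sum_congr rfl fun n _ => ?_
    rw [Finset.sum_mul, ← Finset.sum_add_distrib]
    exact Finset.sum_congr rfl fun i _ => by ring
  have h3 : ∑ n ∈ Finset.Icc 1 N, ∑ i ∈ Finset.Icc 1 n, a n i * (‖φ i‖ ^ 2 / 2) =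
      ∑ i ∈ Finset.Icc 1 N, (∑ n ∈ Finset.Icc i N, a n i) * (‖φ i‖ ^ 2 / 2) := by
    simp only [Finset.sum_mul]
    refine Finset.sum_comm' fun n i => ?_
    simp only [Finset.mem_Icc]
    omega
  rw [h2, h3]
  refine add_nonneg (Finset.sum_nonneg fun n hn => ?_) (Finset.sum_nonneg fun i hi => ?_)
  · exact mul_nonneg (hrow n (Finset.mem_Icc.1 hn).1) (by positivity)
  · exact mul_nonneg (hcol i (Finset.mem_Icc.1 hi).1 (Finset.mem_Icc.1 hi).2) (by positivity)

theorem sum_inner_discreteEKDeriv_nonneg {α β k : ℝ} (hα0 : 0 < α) (hα1 : α ≤ 1) (hβ0 : 0 < β)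
    (hβ1 : β ≤ 1) (hk : 0 < k) (φ : ℕ → E) (N : ℕ) :
    0 ≤ ∑ n ∈ Finset.Icc 1 N,
      α / β * ((n : ℝ) * k) ^ (α - 1) * inner ℝ (discreteEKDeriv α β k φ n) (φ n) := by
  have h := sum_inner_triangular_nonneg
    (fun n i => (n : ℝ) ^ (α - 1) * derivWeight α β n i) φ N
    (fun n i hi hin => mul_nonpos_of_nonneg_of_nonpos (by positivity)
      (derivWeight_nonpos hα0 hα1 hβ0 hβ1 hi hin))
    (fun n hn => by
      rw [← Finset.mul_sum]
      exact mul_nonneg (by positivity) (sum_derivWeight_nonneg hα0 hβ0 hn))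
    (fun i hi hiN => sum_rpow_mul_derivWeight_nonneg hα0 hα1 hβ0 hi hiN)
  have h' := mul_nonneg (Real.rpow_nonneg hk.le (α - 1)) h
  rw [Finset.mul_sum] at h'
  refine h'.trans_eq (Finset.sum_congr rfl fun n hn => ?_)
  simp only [mul_smul]
  rw [← Finset.smul_sum, ← smul_discreteEKDeriv hα0 hβ0 hk φ (Finset.mem_Icc.1 hn).1,
    real_inner_smul_left, real_inner_smul_left, Real.mul_rpow (Nat.cast_nonneg n) hk.le]
  ring

end Positivity

/-! ### Weak derivatives and the elliptic problem -/

theorem integral_mul_eq_inner_toLp (u : L2R) {f : ℝ → ℝ} (hf : MemLp f 2 (volume : Measure ℝ)) :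
    ∫ x, u x * f x = inner ℝ u (hf.toLp f) := by
  rw [L2.inner_def]
  refine integral_congr_ae ?_
  filter_upwards [hf.coeFn_toLp] with x hx
  rw [hx]
  simp [mul_comm]

/-- In terms of `L²` inner products, the condition is visibly linear and closed in `(u, v)`. -/
theorem hasWeakDeriv_iff {u v : L2R} : HasWeakDeriv u v ↔
    ∀ (φ : ℝ → ℝ) (hφ : MemLp φ 2 (volume : Measure ℝ))
      (hφ' : MemLp (deriv φ) 2 (volume : Measure ℝ)), ContDiff ℝ ∞ φ → HasCompactSupport φ →
      inner ℝ u (hφ'.toLp (deriv φ)) + inner ℝ v (hφ.toLp φ) = 0 := by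
  refine ⟨fun h φ hφ hφ' hc hs => ?_, fun h φ hc hs => ?_⟩
  · rw [← integral_mul_eq_inner_toLp, ← integral_mul_eq_inner_toLp, h φ hc hs, neg_add_cancel]
  · have h1 : MemLp φ 2 (volume : Measure ℝ) := hc.continuous.memLp_of_hasCompactSupport hs
    have h2 : MemLp (deriv φ) 2 (volume : Measure ℝ) :=
      (hc.continuous_deriv (by simp)).memLp_of_hasCompactSupport hs.deriv
    rw [integral_mul_eq_inner_toLp u h2, integral_mul_eq_inner_toLp v h1]
    exact eq_neg_of_add_eq_zero_left (h φ h1 h2 hc hs)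

/-- The graph of the weak derivative, as a subspace of `L²(ℝ) × L²(ℝ)` with its Hilbert norm; the
second component is scaled by `μ⁻¹`. -/
def scaledGraph (μ : ℝ) : Submodule ℝ (WithLp 2 (L2R × L2R)) where
  carrier := {p | HasWeakDeriv p.fst (μ • p.snd)}
  zero_mem' := by
    simp only [Set.mem_ofPred_eq, hasWeakDeriv_iff]
    intro φ hφ hφ' _ _
    simp
  add_mem' {p q} hp hq := by
    simp only [Set.mem_ofPred_eq, hasWeakDeriv_iff] at *
    intro φ hφ hφ' hc hs
    have h1 := hp φ hφ hφ' hc hs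
    have h2 := hq φ hφ hφ' hc hs
    simp only [WithLp.add_fst, WithLp.add_snd, smul_add, inner_add_left]
    linarith
  smul_mem' c p hp := by
    simp only [Set.mem_ofPred_eq, hasWeakDeriv_iff] at *
    intro φ hφ hφ' hc hs
    have h1 := hp φ hφ hφ' hc hs
    simp only [WithLp.smul_fst, WithLp.smul_snd, real_inner_smul_left] at h1 ⊢
    linear_combination c * h1

theorem mem_scaledGraph {μ : ℝ} {p : WithLp 2 (L2R × L2R)} :
    p ∈ scaledGraph μ ↔ HasWeakDeriv p.fst (μ • p.snd) := Iff.rfl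

theorem isClosed_scaledGraph (μ : ℝ) : IsClosed (scaledGraph μ : Set (WithLp 2 (L2R × L2R))) := by
  have : (scaledGraph μ : Set (WithLp 2 (L2R × L2R))) = {p | HasWeakDeriv p.fst (μ • p.snd)} := rfl
  rw [this]
  simp only [hasWeakDeriv_iff, Set.ofPred_forall]
  refine isClosed_iInter fun φ => isClosed_iInter fun hφ => isClosed_iInter fun hφ' =>
    isClosed_iInter fun _ => isClosed_iInter fun _ => isClosed_eq ?_ continuous_const
  have c1 : Continuous fun p : WithLp 2 (L2R × L2R) => p.fst := WithLp.continuous_fst 2 _ _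
  have c2 : Continuous fun p : WithLp 2 (L2R × L2R) => p.snd := WithLp.continuous_snd 2 _ _
  fun_prop

theorem hasWeakDeriv_weakDeriv {u : L2R} (hu : u ∈ H1) : HasWeakDeriv u (weakDeriv u) := by
  obtain ⟨v, hv⟩ := hu
  rwa [hv.weakDeriv_eq]

theorem HasWeakDeriv.sub {u v u' v' : L2R} (h : HasWeakDeriv u v) (h' : HasWeakDeriv u' v') :
    HasWeakDeriv (u - u') (v - v') := by
  have := (scaledGraph 1).sub_mem (x := WithLp.toLp 2 (u, v)) (y := WithLp.toLp 2 (u', v'))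
    (by simpa [mem_scaledGraph] using h) (by simpa [mem_scaledGraph] using h')
  simpa [mem_scaledGraph] using this

/-- The weak form of the elliptic problem `V - c V_xx = f - g_x` on the line has exactly one
solution in `H¹(ℝ)`. -/
theorem existsUnique_elliptic {c : ℝ} (hc : 0 < c) (f g : L2R) :
    ∃! V : L2R, V ∈ H1 ∧ ∀ χ ∈ H1,
      inner ℝ V χ + c * inner ℝ (weakDeriv V) (weakDeriv χ) =
        inner ℝ f χ + inner ℝ g (weakDeriv χ) := by
  set s := √c with hs
  have hs0 : 0 < s := Real.sqrt_pos.2 hc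
  have hsc : s * s = c := Real.mul_self_sqrt hc.le
  refine existsUnique_of_exists_of_unique ?_ ?_
  · have : CompleteSpace (scaledGraph s⁻¹) := (isClosed_scaledGraph s⁻¹).completeSpace_coe
    -- On pairs `(V, s V_x)` with `s² = c`, the energy form is the product inner product, and the
    -- right-hand side is pairing with `q`. The solution is thus the projection of `q`.
    set q : WithLp 2 (L2R × L2R) := WithLp.toLp 2 (f, s⁻¹ • g)
    set p : WithLp 2 (L2R × L2R) := (scaledGraph s⁻¹).starProjection q with hp
    have hpm : HasWeakDeriv p.fst (s⁻¹ • p.snd) :=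
      mem_scaledGraph.1 ((scaledGraph s⁻¹).starProjection_apply_mem q)
    refine ⟨p.fst, ⟨_, hpm⟩, fun χ hχ => ?_⟩
    have hχm : WithLp.toLp 2 (χ, s • weakDeriv χ) ∈ scaledGraph s⁻¹ := by
      rw [mem_scaledGraph]
      simpa [smul_smul, inv_mul_cancel₀ hs0.ne'] using hasWeakDeriv_weakDeriv hχ
    have h := (scaledGraph s⁻¹).starProjection_inner_eq_zero q _ hχm
    rw [← hp, inner_sub_left, WithLp.prod_inner_apply, WithLp.prod_inner_apply] at h
    simp only [q, real_inner_smul_left, real_inner_smul_right] at h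
    rw [hpm.weakDeriv_eq, real_inner_smul_left, ← hsc]
    have e : s * (s⁻¹ * inner ℝ g (weakDeriv χ)) = inner ℝ g (weakDeriv χ) := by
      field_simp
    have e' : s * s * (s⁻¹ * inner ℝ p.snd (weakDeriv χ)) = s * inner ℝ p.snd (weakDeriv χ) := by
      field_simp
    change inner ℝ f χ + s * (s⁻¹ * inner ℝ g (weakDeriv χ)) -
      (inner ℝ p.fst χ + s * inner ℝ p.snd (weakDeriv χ)) = 0 at h
    rw [e] at h
    rw [e']
    linarith
  · rintro V W ⟨hV, hV'⟩ ⟨hW, hW'⟩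
    have hd := (hasWeakDeriv_weakDeriv hV).sub (hasWeakDeriv_weakDeriv hW)
    have h1 := hV' _ ⟨_, hd⟩
    have h2 := hW' _ ⟨_, hd⟩
    rw [hd.weakDeriv_eq] at h1 h2
    have h3 : inner ℝ (V - W) (V - W) +
        c * inner ℝ (weakDeriv V - weakDeriv W) (weakDeriv V - weakDeriv W) = 0 := by
      rw [inner_sub_left (𝕜 := ℝ) V W, inner_sub_left (𝕜 := ℝ) (weakDeriv V)]
      linarith
    rw [real_inner_self_eq_norm_sq, real_inner_self_eq_norm_sq] at h3
    have h4 : ‖V - W‖ ^ 2 = 0 :=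
      le_antisymm (by nlinarith [mul_nonneg hc.le (sq_nonneg ‖weakDeriv V - weakDeriv W‖)])
        (sq_nonneg _)
    exact sub_eq_zero.1 (norm_eq_zero.1 (pow_eq_zero_iff two_ne_zero |>.1 h4))

/-! ### Recursive construction of sequences -/

/-- A recursion whose step is uniquely solvable given the previous values has exactly one
solution with a given initial value. -/
theorem existsUnique_seq_of_step {X : Type*} (P : ℕ → (ℕ → X) → Prop)
    (hloc : ∀ n U V, (∀ i ≤ n, U i = V i) → P n U → P n V)
    (hstep : ∀ n U, 1 ≤ n → (∀ i, 1 ≤ i → i < n → P i U) → ∃! V, P n (Function.update U n V))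
    (x₀ : X) : ∃! U : ℕ → X, U 0 = x₀ ∧ ∀ n, 1 ≤ n → P n U := by
  have huniq : ∀ (N : ℕ) (U V : ℕ → X), U 0 = V 0 → (∀ n, 1 ≤ n → n ≤ N → P n U) →
      (∀ n, 1 ≤ n → n ≤ N → P n V) → ∀ n ≤ N, U n = V n := by
    intro N U V h0 hU hV n
    induction n using Nat.strong_induction_on with
    | _ n ih =>
      intro hn
      rcases Nat.eq_zero_or_pos n with rfl | hpos
      · exact h0
      refine (hstep n U hpos fun i hi hin => hU i hi (by omega)).unique ?_ ?_
      · rw [Function.update_eq_self]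
        exact hU n hpos hn
      · refine hloc n V _ (fun i hi => ?_) (hV n hpos hn)
        rcases hi.eq_or_lt with rfl | hlt
        · simp
        · rw [Function.update_of_ne hlt.ne, ih i hlt (by omega)]
  have hfin : ∀ N : ℕ, ∃ U : ℕ → X, U 0 = x₀ ∧ ∀ n, 1 ≤ n → n ≤ N → P n U := by
    intro N
    induction N with
    | zero => exact ⟨fun _ => x₀, rfl, fun n h1 h2 => by omega⟩
    | succ N ih =>
      obtain ⟨U, h0, hU⟩ := ih
      obtain ⟨V, hV, -⟩ := hstep (N + 1) U (by omega) fun i hi hiN => hU i hi (by omega)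
      refine ⟨Function.update U (N + 1) V, by simp [h0], fun n h1 h2 => ?_⟩
      rcases h2.eq_or_lt with rfl | hlt
      · exact hV
      · refine hloc n U _ (fun i hi => ?_) (hU n h1 (by omega))
        rw [Function.update_of_ne (by omega)]
  choose F hF0 hF using hfin
  -- The chosen finite solutions are a priori unrelated; uniqueness makes them agree, so their
  -- diagonal solves every step.
  have hagree : ∀ N i, i ≤ N → F i i = F N i := fun N i hi =>
    huniq i (F i) (F N) ((hF0 i).trans (hF0 N).symm) (hF i)
      (fun n h1 h2 => hF N n h1 (by omega)) i le_rfl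
  refine ⟨fun n => F n n, ⟨hF0 0, fun n hn => ?_⟩, fun V hV => funext fun n => ?_⟩
  · exact hloc n (F n) _ (fun i hi => (hagree n i hi).symm) (hF n n hn le_rfl)
  · exact huniq n V (F n) (hV.1.trans (hF0 n).symm) (fun m h1 _ => hV.2 m h1) (hF n) n le_rfl

/-! ### Solvability and stability of the scheme -/

section Scheme

variable {α β k : ℝ}

theorem discreteEKInt_congr {E : Type*} [AddCommGroup E] [Module ℝ E] {φ ψ : ℕ → E} {n : ℕ}
    (h : ∀ i ≤ n, φ i = ψ i) : discreteEKInt α β φ n = discreteEKInt α β ψ n :=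
  Finset.sum_congr rfl fun i hi => by rw [h i (Finset.mem_Icc.1 hi).2]

theorem StepEq.congr {U V : ℕ → L2R} {n : ℕ} (h : ∀ i ≤ n, U i = V i)
    (hU : StepEq α β k U n) : StepEq α β k V n := by
  intro χ hχ
  have := hU χ hχ
  have e : discreteEKDeriv α β k (fun i => weakDeriv (U i)) n =
      discreteEKDeriv α β k (fun i => weakDeriv (V i)) n := by
    rw [discreteEKDeriv, discreteEKDeriv, discreteEKInt_congr fun i hi => by rw [h i hi],
      discreteEKInt_congr (n := n - 1) fun i hi => by rw [h i (hi.trans (Nat.sub_le n 1))]]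
  rwa [e, h n le_rfl, h (n - 1) (Nat.sub_le n 1)] at this

/-- With the history moved to the right, the step is elliptic with `c = k t_n^(α-1) derivWeight α β
n n`. -/
theorem stepEq_update_iff (hα : 0 < α) (hβ : 0 < β) (hk : 0 < k) (U : ℕ → L2R) (V : L2R) {n : ℕ}
    (hn : 1 ≤ n) : StepEq α β k (Function.update U n V) n ↔ ∀ χ ∈ H1,
      inner ℝ V χ + k * ((n : ℝ) * k) ^ (α - 1) * derivWeight α β n n *
          inner ℝ (weakDeriv V) (weakDeriv χ) =
        inner ℝ (U (n - 1)) χ + inner ℝ (-(k * ((n : ℝ) * k) ^ (α - 1)) •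
          ∑ i ∈ Finset.Icc 1 (n - 1), derivWeight α β n i • weakDeriv (U i)) (weakDeriv χ) := by
  refine forall₂_congr fun χ _ => ?_
  have hG := smul_discreteEKDeriv hα hβ hk
    (fun i => weakDeriv (Function.update U n V i)) hn
  obtain ⟨m, rfl⟩ : ∃ m, n = m + 1 := ⟨n - 1, by omega⟩
  rw [Finset.sum_Icc_succ_top (by omega)] at hG
  have hS : ∑ i ∈ Finset.Icc 1 m, derivWeight α β (m + 1) i •
      weakDeriv (Function.update U (m + 1) V i) =
      ∑ i ∈ Finset.Icc 1 m, derivWeight α β (m + 1) i • weakDeriv (U i) := by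
    refine Finset.sum_congr rfl fun i hi => ?_
    rw [Function.update_of_ne (by have := (Finset.mem_Icc.1 hi).2; omega)]
  rw [hS, Function.update_self] at hG
  have hG' := congrArg (fun x => (inner ℝ x (weakDeriv χ) : ℝ)) hG
  simp only [real_inner_smul_left, inner_add_left] at hG'
  rw [Nat.add_sub_cancel, Function.update_self, Function.update_of_ne (by omega),
    real_inner_smul_left, real_inner_smul_left, inner_sub_left,
    mul_right_comm (α / β), hG']
  field_simp
  constructor <;> intro h <;> linarith

theorem existsUnique_step (hα : 0 < α) (hβ : 0 < β) (hk : 0 < k) (U : ℕ → L2R) {n : ℕ}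
    (hn : 1 ≤ n) : ∃! V : L2R, V ∈ H1 ∧ StepEq α β k (Function.update U n V) n := by
  have hn' : (0 : ℝ) < n := by exact_mod_cast hn
  simp only [stepEq_update_iff hα hβ hk U _ hn]
  exact existsUnique_elliptic
    (mul_pos (by positivity) (derivWeight_self_pos hα hβ hn)) _ _

theorem existsUnique_isSchemeSolution (hα : 0 < α) (hβ : 0 < β) (hk : 0 < k) (u₀ : L2R) :
    ∃! U : ℕ → L2R, IsSchemeSolution α β k u₀ U := by
  refine existsUnique_seq_of_step (fun n U => U n ∈ H1 ∧ StepEq α β k U n)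
    (fun n U V h hU => ⟨h n le_rfl ▸ hU.1, hU.2.congr h⟩) (fun n U hn _ => ?_) u₀
  simpa only [Function.update_self] using existsUnique_step hα hβ hk U hn

/-- Solutions of the scheme do not grow in `L²(ℝ)`. -/
theorem IsSchemeSolution.norm_le (hα0 : 0 < α) (hα1 : α ≤ 1) (hβ0 : 0 < β) (hβ1 : β ≤ 1)
    (hk : 0 < k) {u₀ : L2R} {U : ℕ → L2R} (hU : IsSchemeSolution α β k u₀ U) (N : ℕ) :
    ‖U N‖ ≤ ‖U 0‖ := by
  have key : ∀ N : ℕ, ‖U N‖ ^ 2 + 2 * k * ∑ n ∈ Finset.Icc 1 N, α / β * ((n : ℝ) * k) ^ (α - 1) *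
      inner ℝ (discreteEKDeriv α β k (fun i => weakDeriv (U i)) n) (weakDeriv (U n)) ≤
      ‖U 0‖ ^ 2 := by
    intro N
    induction N with
    | zero => simp
    | succ N ih =>
      obtain ⟨h1, h2⟩ := hU.2 (N + 1) (by omega)
      have h3 := h2 _ h1
      rw [Finset.sum_Icc_succ_top (by omega), mul_add]
      rw [Nat.add_sub_cancel, real_inner_smul_left] at h3
      set y := α / β * (((N + 1 : ℕ) : ℝ) * k) ^ (α - 1) *
        inner ℝ (discreteEKDeriv α β k (fun i => weakDeriv (U i)) (N + 1)) (weakDeriv (U (N + 1)))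
      have h4 : inner ℝ (U (N + 1) - U N) (U (N + 1)) = -(k * y) := by
        field_simp at h3
        linarith
      rw [inner_sub_left, real_inner_self_eq_norm_sq] at h4
      -- `2(a - b, a) = ‖a‖² - ‖b‖² + ‖a - b‖²`; the last square is dropped.
      have h5 := norm_sub_sq_real (U N) (U (N + 1))
      nlinarith [sq_nonneg ‖U N - U (N + 1)‖]
  have hpos := sum_inner_discreteEKDeriv_nonneg hα0 hα1 hβ0 hβ1 hk (fun i => weakDeriv (U i)) N
  have := mul_nonneg (mul_nonneg zero_le_two hk.le) hpos
  exact le_of_sq_le_sq (by linarith [key N]) (norm_nonneg _)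

end Scheme

end EKDiffusion

theorem mainTheorem3 (α β k : ℝ) (hα0 : 0 < α) (hα1 : α < 1) (hβ0 : 0 < β) (hβ1 : β < 1)
    (hk : 0 < k) :
    (∀ (n : ℕ) (U : ℕ → EKDiffusion.L2R), 1 ≤ n →
      (∀ i : ℕ, 1 ≤ i → i < n → U i ∈ EKDiffusion.H1) →
        ∃! V : EKDiffusion.L2R, V ∈ EKDiffusion.H1 ∧
          EKDiffusion.StepEq α β k (Function.update U n V) n) ∧
    (∀ u₀ : EKDiffusion.L2R,
      (∃! U : ℕ → EKDiffusion.L2R, EKDiffusion.IsSchemeSolution α β k u₀ U) ∧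
      ∀ U : ℕ → EKDiffusion.L2R, EKDiffusion.IsSchemeSolution α β k u₀ U →
        ∀ n : ℕ, ‖U n‖ ≤ √2 * ‖U 0‖) := by
  refine ⟨fun n U hn _ => EKDiffusion.existsUnique_step hα0 hβ0 hk U hn, fun u₀ =>
    ⟨EKDiffusion.existsUnique_isSchemeSolution hα0 hβ0 hk u₀, fun U hU n => ?_⟩⟩
  refine (hU.norm_le hα0 hα1.le hβ0 hβ1.le hk n).trans
    (le_mul_of_one_le_left (norm_nonneg _) ?_)
  exact Real.one_le_sqrt.2 one_le_two
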